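/- Let $R$ be a commutative Noetherian local ring with maximal ideal $\mathfrak m$, and let $M$ be a finitely generated $R$-module. Write $N^*=\operatorname{Hom}_R(N,R)$. For a finitely generated $R$-module $N$, let $\beta_n(N)$ be the rank of the $n$-th module $F_n$ in a minimal free resolution $F$ of $N$, and let $\Omega^n_R N$ be the $n$-th syzygy of $N$ in $F$ (so $\Omega^0_RN=N$). The complexity $\operatorname{cx}_R(N)$ is the least integer $r\ge 0$ such that there is a real number $A$ with $\beta_n(N)\le A\,n^{r-1}$ for all $n\gg 0$, and $\operatorname{cx}_R(N)=\infty$ if there is no such $r$. The module $M$ is totally reflexive if the biduality map $M\to M^{**}$ is an isomorphism and $\operatorname{Ext}^i_R(M,R)=0=\operatorname{Ext}^i_R(M^*,R)$ for all $i>0$. The reducing projective dimension $\operatorname{red-pd}_R(M)\in\mathbb N\cup\{\infty\}$ is $0$ if $\operatorname{pd}_R(M)<\infty$. Otherwise it is the least integer $r\ge 1$ for which there are finitely generated $R$-modules $K_0=M,K_1,\dots,K_r$ with $\operatorname{pd}_R(K_r)<\infty$, integers $a_i,b_i\ge 1$ and $n_i\ge 0$, and short exact sequences $$0\to K_{i-1}^{\oplus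 a_i}\to K_i\to (\Omega^{n_i}_RK_{i-1})^{\oplus b_i}\to 0\qquad(1\le i\le r),$$ and it is $\infty$ if there is no such $r$. Assume that $M$ is totally reflexive and that $\operatorname{red-pd}_R(M)\le 2$. Then $\operatorname{cx}_R(M)\le 2$ or $\operatorname{cx}_R(M^*)\le 2$. -/

import Mathlib

open CategoryTheory

universe u

/-- A minimal free resolution `⋯ → R^(rank 1) → R^(rank 0) → M → 0` of a module `M` over a
local ring `R` by free modules of finite rank: an exact sequence in which every matrix
`d n` has all its entries in the maximal ideal. -/
structure MinimalFreeResolution (R : Type u) [CommRing R] [IsLocalRing R]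
    (M : Type u) [AddCommGroup M] [Module R M] where
  /-- the rank of the `n`-th free module -/
  rank : ℕ → ℕ
  /-- the augmentation -/
  aug : (Fin (rank 0) → R) →ₗ[R] M
  /-- the differentials -/
  d : ∀ n, (Fin (rank (n + 1)) → R) →ₗ[R] (Fin (rank n) → R)
  aug_surjective : Function.Surjective aug
  exact_zero : Function.Exact (d 0) aug
  exact_succ : ∀ n, Function.Exact (d (n + 1)) (d n)
  minimal : ∀ n x j, d n x j ∈ IsLocalRing.maximalIdeal R

/-- A finitely generated module over a local ring is the image of a finite free module under
a map whose kernel lies in `𝔪 F`. -/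
theorem exists_minimal_cover (R : Type u) [CommRing R] [IsLocalRing R]
    (M : Type u) [AddCommGroup M] [Module R M] [Module.Finite R M] :
    ∃ (k : ℕ) (p : (Fin k → R) →ₗ[R] M), Function.Surjective p ∧
      ∀ x, p x = 0 → ∀ j, x j ∈ IsLocalRing.maximalIdeal R := by
  classical
  let P : ℕ → Prop := fun k => ∃ v : Fin k → M, Submodule.span R (Set.range v) = ⊤
  have hP : ∃ k, P k := by
    obtain ⟨n, s, hs⟩ := Module.Finite.exists_fin (R := R) (M := M)
    exact ⟨n, s, hs⟩
  obtain ⟨v, hv⟩ := Nat.find_spec hP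
  have hmin : ∀ m < Nat.find hP, ¬ P m := fun m hm => Nat.find_min hP hm
  generalize Nat.find hP = k at v hv hmin
  refine ⟨k, Fintype.linearCombination R v, ?_, ?_⟩
  · rw [← LinearMap.range_eq_top, Fintype.range_linearCombination, hv]
  · intro x hx j
    by_contra hj
    have hu : IsUnit (x j) := by simpa using hj
    cases k with
    | zero => exact j.elim0
    | succ m =>
      refine hmin m (Nat.lt_succ_self m) ⟨fun i => v (j.succAbove i), ?_⟩
      rw [eq_top_iff, ← hv, Submodule.span_le]
      rintro _ ⟨i, rfl⟩
      rcases Fin.eq_self_or_eq_succAbove j i with rfl | ⟨i', rfl⟩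
      · rw [Fintype.linearCombination_apply, Fin.sum_univ_succAbove _ i] at hx
        have hmem : x i • v i ∈ Submodule.span R (Set.range fun i' => v (i.succAbove i')) := by
          rw [eq_neg_of_add_eq_zero_left hx]
          exact Submodule.neg_mem _ (Submodule.sum_mem _ fun i' _ =>
            Submodule.smul_mem _ _ (Submodule.subset_span ⟨i', rfl⟩))
        obtain ⟨c, hc⟩ := hu
        have h2 := Submodule.smul_mem _ (↑c⁻¹ : R) hmem
        rwa [smul_smul, ← hc, Units.inv_mul, one_smul] at h2
      · exact Submodule.subset_span ⟨i', rfl⟩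

/-- Over a Noetherian local ring every finitely generated module has a minimal free
resolution. -/
theorem nonempty_minimalFreeResolution (R : Type u) [CommRing R] [IsNoetherianRing R]
    [IsLocalRing R] (M : Type u) [AddCommGroup M] [Module R M] [Module.Finite R M] :
    Nonempty (MinimalFreeResolution R M) := by
  classical
  obtain ⟨k₀, p₀, hp₀, hk₀⟩ := exists_minimal_cover R M
  choose k p hp hk using fun S : Σ m : ℕ, Submodule R (Fin m → R) => exists_minimal_cover R S.2
  let S : ℕ → Σ m : ℕ, Submodule R (Fin m → R) := fun n =>
    Nat.rec ⟨k₀, LinearMap.ker p₀⟩ (fun _ T => ⟨k T, LinearMap.ker (p T)⟩) n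
  have hS : ∀ n x, x ∈ (S n).2 → ∀ j, x j ∈ IsLocalRing.maximalIdeal R := by
    intro n
    cases n with
    | zero => exact fun x hx j => hk₀ x hx j
    | succ n => exact fun x hx j => hk (S n) x hx j
  refine ⟨⟨fun n => (S n).1, p₀, fun n => (S n).2.subtype ∘ₗ p (S n), hp₀, ?_, ?_, ?_⟩⟩
  · intro x
    constructor
    · intro hx
      obtain ⟨y, hy⟩ := hp (S 0) ⟨x, hx⟩
      exact ⟨y, congrArg Subtype.val hy⟩
    · rintro ⟨y, rfl⟩
      exact (p (S 0) y).2
  · intro n x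
    constructor
    · intro hx
      have hx' : x ∈ (S (n + 1)).2 := Subtype.ext hx
      obtain ⟨y, hy⟩ := hp (S (n + 1)) ⟨x, hx'⟩
      exact ⟨y, congrArg Subtype.val hy⟩
    · rintro ⟨y, rfl⟩
      have h : p (S n) (p (S (n + 1)) y).1 = 0 := (p (S (n + 1)) y).2
      exact congrArg Subtype.val h
  · exact fun n x j => hS n _ (p (S n) x).2 j

noncomputable section

/-- A chosen minimal free resolution (it is unique up to isomorphism). -/
def minimalFreeResolution (R : Type u) [CommRing R] [IsNoetherianRing R] [IsLocalRing R]
    (M : Type u) [AddCommGroup M] [Module R M] [Module.Finite R M] :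
    MinimalFreeResolution R M :=
  Classical.choice (nonempty_minimalFreeResolution R M)

/-- The `n`-th Betti number of `M`: the rank of the `n`-th module of a minimal free
resolution. -/
def betti (R : Type u) [CommRing R] [IsNoetherianRing R] [IsLocalRing R]
    (M : Type u) [AddCommGroup M] [Module R M] [Module.Finite R M] (n : ℕ) : ℕ :=
  (minimalFreeResolution R M).rank n

/-- The `n`-th syzygy `Ω^n M` in the minimal free resolution `F` of `M`, written uniformly in
`n ≥ 0` as the cokernel of `F_{n+1} → F_n`. By exactness this is `M` for `n = 0` and the image
of `F_n → F_{n-1}` for `n ≥ 1`; see `syzygyZeroEquiv` and `syzygySuccEquiv`. -/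
abbrev Syzygy (R : Type u) [CommRing R] [IsNoetherianRing R] [IsLocalRing R]
    (M : Type u) [AddCommGroup M] [Module R M] [Module.Finite R M] (n : ℕ) : Type u :=
  (Fin ((minimalFreeResolution R M).rank n) → R) ⧸
    LinearMap.range ((minimalFreeResolution R M).d n)

/-- `Ω^0 M ≅ M`. -/
def syzygyZeroEquiv (R : Type u) [CommRing R] [IsNoetherianRing R] [IsLocalRing R]
    (M : Type u) [AddCommGroup M] [Module R M] [Module.Finite R M] : Syzygy R M 0 ≃ₗ[R] M :=
  (Submodule.quotEquivOfEq _ _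
    (LinearMap.exact_iff.mp (minimalFreeResolution R M).exact_zero).symm).trans
    (LinearMap.quotKerEquivOfSurjective _ (minimalFreeResolution R M).aug_surjective)

/-- `Ω^(n+1) M` is the image of the `n`-th differential of the minimal free resolution. -/
def syzygySuccEquiv (R : Type u) [CommRing R] [IsNoetherianRing R] [IsLocalRing R]
    (M : Type u) [AddCommGroup M] [Module R M] [Module.Finite R M] (n : ℕ) :
    Syzygy R M (n + 1) ≃ₗ[R] LinearMap.range ((minimalFreeResolution R M).d n) :=
  (Submodule.quotEquivOfEq _ _
    (LinearMap.exact_iff.mp ((minimalFreeResolution R M).exact_succ n)).symm).trans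
    (LinearMap.quotKerEquivRange _)

/-- The complexity of `M`: the least integer `r ≥ 0` such that there is a real number `A` with
`β_n(M) ≤ A n^(r-1)` for all `n ≫ 0`, and `∞` if there is no such `r`. -/
def complexity (R : Type u) [CommRing R] [IsNoetherianRing R] [IsLocalRing R]
    (M : Type u) [AddCommGroup M] [Module R M] [Module.Finite R M] : ℕ∞ :=
  ⨅ (r : ℕ) (_ : ∃ A : ℝ, ∀ᶠ n : ℕ in Filter.atTop,
    (betti R M n : ℝ) ≤ A * (n : ℝ) ^ ((r : ℤ) - 1)), (r : ℕ∞)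

/-- A finitely generated module `M` is totally reflexive if the biduality map `M → M**` is
an isomorphism and `Ext^i(M, R) = 0 = Ext^i(M*, R)` for all `i > 0`. -/
structure IsTotallyReflexive (R : Type u) [CommRing R]
    (M : Type u) [AddCommGroup M] [Module R M] : Prop where
  finite : Module.Finite R M
  reflexive : Module.IsReflexive R M
  ext_eq_zero : ∀ i : ℕ, 0 < i →
    Subsingleton (Abelian.Ext (ModuleCat.of R M) (ModuleCat.of R R) i)
  ext_dual_eq_zero : ∀ i : ℕ, 0 < i →
    Subsingleton (Abelian.Ext (ModuleCat.of R (Module.Dual R M)) (ModuleCat.of R R) i)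

/-- A sequence `K_0, …, K_r` of finitely generated modules with `K_0 ≅ M`, with
`pd K_r < ∞`, and with short exact sequences
`0 → K_i^{⊕ a_i} → K_{i+1} → (Ω^{n_i} K_i)^{⊕ b_i} → 0`, where `a_i, b_i ≥ 1` and `n_i ≥ 0`.
For `r ≥ 1` this is a reducing pd-sequence of `M`; for `r = 0` it only says that
`M` has finite projective dimension. -/
structure ReducingPdSequence (R : Type u) [CommRing R] [IsNoetherianRing R] [IsLocalRing R]
    (M : Type u) [AddCommGroup M] [Module R M] (r : ℕ) where
  K : Fin (r + 1) → ModuleCat.{u} R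
  finite : ∀ i, Module.Finite R (K i)
  iso : K 0 ≃ₗ[R] M
  a : Fin r → ℕ
  b : Fin r → ℕ
  n : Fin r → ℕ
  one_le_a : ∀ i, 1 ≤ a i
  one_le_b : ∀ i, 1 ≤ b i
  f : ∀ i : Fin r, (Fin (a i) → K i.castSucc) →ₗ[R] K i.succ
  g : ∀ i : Fin r, K i.succ →ₗ[R] (Fin (b i) → Syzygy R (K i.castSucc) (n i))
  f_injective : ∀ i, Function.Injective (f i)
  exact : ∀ i, Function.Exact (f i) (g i)
  g_surjective : ∀ i, Function.Surjective (g i)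
  pd_last_lt_top : projectiveDimension (K (Fin.last r)) < ⊤

/-- The reducing projective dimension of `M`: it is `0` if `pd M < ∞`; otherwise it is the
least length `r` of a reducing pd-sequence of `M`, and `∞` if there is none. Both cases are
covered by one infimum, because a sequence of length `r = 0` exists exactly when
`pd M < ∞`. -/
def reducingPd (R : Type u) [CommRing R] [IsNoetherianRing R] [IsLocalRing R]
    (M : Type u) [AddCommGroup M] [Module R M] : ℕ∞ :=
  ⨅ (r : ℕ) (_ : Nonempty (ReducingPdSequence R M r)), (r : ℕ∞)

end

/-! Let 0 → K^a → L → (Ω^n K)^b → 0 be one step of a reducing sequence with K totally reflexive;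
then L is totally reflexive too. The long exact sequence of Ext(-, k), with k the residue field,
gives b β_{i+n+1}(K) ≤ a β_i(K) + β_{i+1}(L) (`betti_reducing_le`). The sequence stays exact after
dualizing, and dualizing reverses the syzygy shift, so a β_{i+n+1}(K*) ≤ b β_i(K*) + β_{i+n+1}(L*)
for i ≥ 1 (`betti_dual_reducing_le`). The roles of a and b are exchanged, so for K or for K* the
leading factor is at most 1.

If pd L < ∞, the error terms vanish in high degrees. For a = b both K and K* have bounded Betti
numbers; for a ≠ b one of them has Betti numbers that are eventually zero, and total reflexivity
passes this to the other (`hasBoundedBetti_of_reducing`). If L and L* merely have bounded Betti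
numbers, the recursion still gives linear growth for K or for K* (`complexity_le_two_of_reducing`).
With r = 2, the first argument treats the last step and the second treats the first step. -/

/-! ### Lengths of Ext modules, with values in ℕ∞ so that no finiteness is needed -/

section ExtLength

variable {R : Type u} [CommRing R]
variable {A B C N N' X : Type u} [AddCommGroup A] [Module R A] [AddCommGroup B] [Module R B]
  [AddCommGroup C] [Module R C] [AddCommGroup N] [Module R N] [AddCommGroup N'] [Module R N']
  [AddCommGroup X] [Module R X]

/-- The length of the `R`-module `Ext^i(N, X)`. -/
noncomputable def extLen (R : Type u) [CommRing R] (N X : Type u) [AddCommGroup N] [Module R N]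
    [AddCommGroup X] [Module R X] (i : ℕ) : ℕ∞ :=
  Module.length R (Abelian.Ext (ModuleCat.of R N) (ModuleCat.of R X) i)

theorem extLen_eq_zero_iff (i : ℕ) : extLen R N X i = 0 ↔
    Subsingleton (Abelian.Ext (ModuleCat.of R N) (ModuleCat.of R X) i) :=
  Module.length_eq_zero_iff

/-- The map `Ext^i(B, X) → Ext^i(A, X)` induced by `A → B`. -/
noncomputable abbrev extMap (f : A →ₗ[R] B) (X : Type u) [AddCommGroup X] [Module R X] (i : ℕ) :
    Abelian.Ext (ModuleCat.of R B) (ModuleCat.of R X) i →ₗ[R]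
      Abelian.Ext (ModuleCat.of R A) (ModuleCat.of R X) i :=
  (Abelian.Ext.mk₀ (ModuleCat.ofHom f)).precompOfLinear R (ModuleCat.of R X) (zero_add i)

theorem extMap_comp (g : B →ₗ[R] C) (f : A →ₗ[R] B) (i : ℕ) :
    extMap (g ∘ₗ f) X i = extMap f X i ∘ₗ extMap g X i := by
  ext x
  simp [ModuleCat.ofHom_comp, ← Abelian.Ext.mk₀_comp_mk₀_assoc]

theorem extMap_id (i : ℕ) : extMap (LinearMap.id : A →ₗ[R] A) X i = LinearMap.id := by
  ext x
  simp

theorem extMap_sum {ι : Type*} [Fintype ι] (f : ι → A →ₗ[R] B) (i : ℕ) :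
    extMap (∑ j, f j) X i = ∑ j, extMap (f j) X i := by
  ext x
  have : ModuleCat.ofHom (∑ j, f j) = ∑ j, ModuleCat.ofHom (f j) := by
    ext x
    simp
  simp [this, Abelian.Ext.mk₀_sum, Abelian.Ext.sum_comp]

theorem extMap_zero (i : ℕ) : extMap (0 : A →ₗ[R] B) X i = 0 := by
  ext x
  have : ModuleCat.ofHom (0 : A →ₗ[R] B) = 0 := rfl
  simp [this]

/-- `Ext^i(-, X)` turns isomorphisms into isomorphisms. -/
noncomputable def extCongr (e : N ≃ₗ[R] N') (X : Type u) [AddCommGroup X] [Module R X] (i : ℕ) :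
    Abelian.Ext (ModuleCat.of R N) (ModuleCat.of R X) i ≃ₗ[R]
      Abelian.Ext (ModuleCat.of R N') (ModuleCat.of R X) i :=
  LinearEquiv.ofLinearMap (extMap e.symm.toLinearMap X i) (extMap e.toLinearMap X i)
    (by rw [← extMap_comp, ← extMap_id]; congr 1; ext; simp)
    (by rw [← extMap_comp, ← extMap_id]; congr 1; ext; simp)

theorem extLen_congr (e : N ≃ₗ[R] N') (i : ℕ) : extLen R N X i = extLen R N' X i :=
  (extCongr e X i).length_eq

/-- `Ext^i(N^a, X) = Ext^i(N, X)^a`. -/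
noncomputable def extPi (a : ℕ) (N X : Type u) [AddCommGroup N] [Module R N]
    [AddCommGroup X] [Module R X] (i : ℕ) :
    Abelian.Ext (ModuleCat.of R (Fin a → N)) (ModuleCat.of R X) i ≃ₗ[R]
      (Fin a → Abelian.Ext (ModuleCat.of R N) (ModuleCat.of R X) i) :=
  LinearEquiv.ofLinearMap
    (LinearMap.pi fun j => extMap (LinearMap.single R (fun _ : Fin a => N) j) X i)
    (∑ j, extMap (LinearMap.proj j) X i ∘ₗ LinearMap.proj j)
    (by
      refine LinearMap.pi_ext' fun l => ?_
      ext x j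
      have h : ∀ j l : Fin a, ∀ y, extMap (LinearMap.single R (fun _ : Fin a => N) j) X i
          (extMap (LinearMap.proj l : (Fin a → N) →ₗ[R] N) X i y) = if j = l then y else 0 := by
        intro j l y
        rw [← LinearMap.comp_apply, ← extMap_comp]
        split_ifs with hjl
        · subst hjl
          rw [LinearMap.proj_comp_single_same, extMap_id]; rfl
        · rw [LinearMap.proj_comp_single_ne _ _ _ _ (Ne.symm hjl), extMap_zero]; rfl
      simp only [LinearMap.comp_apply, LinearMap.pi_apply, LinearMap.sum_apply, map_sum, h,
        LinearMap.proj_apply, LinearMap.id_apply, Finset.sum_ite_eq, Finset.mem_univ, if_true])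
    (by
      have h : ∑ j, (LinearMap.single R (fun _ : Fin a => N) j) ∘ₗ
          (LinearMap.proj j : (Fin a → N) →ₗ[R] N) = LinearMap.id := by
        ext j x l
        simp [Finset.sum_apply, Pi.single_apply]
      rw [← extMap_id, ← h, extMap_sum]
      ext x
      simp only [extMap_comp, LinearMap.comp_apply, LinearMap.sum_apply, LinearMap.proj_apply,
        LinearMap.pi_apply])

theorem extLen_pi (a : ℕ) (i : ℕ) : extLen R (Fin a → N) X i = a * extLen R N X i := by
  rw [extLen, (extPi a N X i).length_eq, Module.length_pi_of_fintype]
  simp [extLen]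

/-- The long exact sequence of `Ext(-, X)`. -/
theorem ext_long_exact {f : A →ₗ[R] B} {g : B →ₗ[R] C} (hf : Function.Injective f)
    (hfg : Function.Exact f g) (hg : Function.Surjective g)
    (X : Type u) [AddCommGroup X] [Module R X] (i : ℕ) :
    ∃ δ : Abelian.Ext (ModuleCat.of R A) (ModuleCat.of R X) i →ₗ[R]
        Abelian.Ext (ModuleCat.of R C) (ModuleCat.of R X) (i + 1),
      Function.Exact (extMap g X i) (extMap f X i) ∧ Function.Exact (extMap f X i) δ ∧
        Function.Exact δ (extMap g X (i + 1)) := by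
  let S : ShortComplex (ModuleCat.{u} R) :=
    ShortComplex.mk (ModuleCat.ofHom f) (ModuleCat.ofHom g) (by
      ext x; exact hfg.apply_apply_eq_zero x)
  have hS : S.ShortExact :=
    { exact := (ShortComplex.ShortExact.moduleCat_exact_iff_function_exact S).2 hfg
      mono_f := (ModuleCat.mono_iff_injective _).2 hf
      epi_g := (ModuleCat.epi_iff_surjective _).2 hg }
  refine ⟨hS.extClass.precompOfLinear R (ModuleCat.of R X) (add_comm 1 i), ?_, ?_, ?_⟩
  · exact (ShortComplex.ab_exact_iff_function_exact _).1
      (Abelian.Ext.contravariant_sequence_exact₂' hS (ModuleCat.of R X) i)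
  · exact (ShortComplex.ab_exact_iff_function_exact _).1
      (Abelian.Ext.contravariant_sequence_exact₁' hS (ModuleCat.of R X) i (i + 1) (add_comm 1 i))
  · exact (ShortComplex.ab_exact_iff_function_exact _).1
      (Abelian.Ext.contravariant_sequence_exact₃' hS (ModuleCat.of R X) i (i + 1) (add_comm 1 i))

theorem length_le_of_exact {P Q S : Type*} [AddCommGroup P] [Module R P] [AddCommGroup Q]
    [Module R Q] [AddCommGroup S] [Module R S] {f : P →ₗ[R] Q} {g : Q →ₗ[R] S}
    (h : Function.Exact f g) : Module.length R Q ≤ Module.length R P + Module.length R S := by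
  rw [Module.length_eq_add_of_exact (LinearMap.range f).subtype g.rangeRestrict
    (Submodule.subtype_injective _) (LinearMap.surjective_rangeRestrict g)
    (by rw [LinearMap.exact_iff, LinearMap.ker_rangeRestrict, Submodule.range_subtype]
        exact LinearMap.exact_iff.1 h)]
  exact add_le_add
    (Module.length_le_of_surjective f.rangeRestrict (LinearMap.surjective_rangeRestrict f))
    (Module.length_le_of_injective _ (Submodule.subtype_injective _))

section ShortExact

variable {f : A →ₗ[R] B} {g : B →ₗ[R] C} (hf : Function.Injective f)
    (hfg : Function.Exact f g) (hg : Function.Surjective g)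
include hf hfg hg

theorem extLen_middle_le (i : ℕ) : extLen R B X i ≤ extLen R C X i + extLen R A X i := by
  obtain ⟨δ, h1, h2, h3⟩ := ext_long_exact hf hfg hg X i
  exact length_le_of_exact h1

theorem extLen_left_le (i : ℕ) : extLen R A X i ≤ extLen R B X i + extLen R C X (i + 1) := by
  obtain ⟨δ, h1, h2, h3⟩ := ext_long_exact hf hfg hg X i
  exact length_le_of_exact h2

theorem extLen_right_le (i : ℕ) :
    extLen R C X (i + 1) ≤ extLen R A X i + extLen R B X (i + 1) := by
  obtain ⟨δ, h1, h2, h3⟩ := ext_long_exact hf hfg hg X i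
  exact length_le_of_exact h3

theorem extLen_dimension_shift (i : ℕ) (h0 : extLen R B X i = 0)
    (h1 : extLen R B X (i + 1) = 0) : extLen R C X (i + 1) = extLen R A X i := by
  apply le_antisymm
  · simpa [h1] using extLen_right_le (X := X) hf hfg hg i
  · simpa [h0] using extLen_left_le (X := X) hf hfg hg i

/-- The obstruction to extending `φ` along `f` is its connecting image in Ext^1(C, X). With X = R
this keeps dual sequences exact on the right. -/
theorem exists_extension_of_extLen_eq_zero (h : extLen R C X 1 = 0) (φ : A →ₗ[R] X) :
    ∃ ψ : B →ₗ[R] X, ψ ∘ₗ f = φ := by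
  obtain ⟨δ, h1, h2, h3⟩ := ext_long_exact hf hfg hg X 0
  have := (extLen_eq_zero_iff (R := R) (N := C) (X := X) 1).1 h
  obtain ⟨y, hy⟩ := (h2 (Abelian.Ext.mk₀ (ModuleCat.ofHom φ))).1 (Subsingleton.elim _ _)
  obtain ⟨ψ, rfl⟩ := (Abelian.Ext.mk₀_bijective _ _).2 y
  refine ⟨ψ.hom, ?_⟩
  simp only [Abelian.Ext.bilinearCompOfLinear_apply_apply, Abelian.Ext.mk₀_comp_mk₀] at hy
  have := (Abelian.Ext.mk₀_bijective _ _).1 hy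
  exact congrArg ModuleCat.Hom.hom this

end ShortExact

theorem extLen_eq_zero_of_projective [Module.Projective R N] (i : ℕ) :
    extLen R N X (i + 1) = 0 := by
  rw [extLen_eq_zero_iff]
  have : Projective (ModuleCat.of R N) := inferInstance
  exact Abelian.Ext.subsingleton_of_projective _ _ i

theorem extLen_zero : extLen R N X 0 = Module.length R (N →ₗ[R] X) :=
  ((Abelian.Ext.linearEquiv₀ (R := R)).trans
    (ModuleCat.homLinearEquiv (S := R))).length_eq

theorem extLen_eq_zero_of_subsingleton [Subsingleton N] (i : ℕ) : extLen R N X i = 0 := by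
  cases i with
  | zero =>
    rw [extLen_zero, Module.length_eq_zero_iff]
    exact ⟨fun a b => by ext x; simp [Subsingleton.elim x 0]⟩
  | succ i => exact extLen_eq_zero_of_projective i

end ExtLength

/-! ### Ext into the residue field and minimal covers -/

section LocalRing

open IsLocalRing

variable {R : Type u} [CommRing R] [IsLocalRing R] {Z N : Type u} [AddCommGroup Z] [Module R Z]
  [AddCommGroup N] [Module R N]

theorem extLen_free_zero (m : ℕ) : extLen R (Fin m → R) (ResidueField R) 0 = m := by
  have : IsSimpleModule R (ResidueField R) := by
    have : IsSimpleModule R (R ⧸ maximalIdeal R) :=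
      isSimpleModule_iff_isCoatom.2 (maximalIdeal.isMaximal R).out
    exact this
  rw [extLen_pi, extLen_zero, (LinearMap.ringLmapEquivSelf R R (ResidueField R)).length_eq,
    Module.length_eq_one, mul_one]

theorem linearMap_residueField_apply_eq_zero {m : ℕ} (φ : (Fin m → R) →ₗ[R] ResidueField R)
    {x : Fin m → R} (hx : ∀ j, x j ∈ maximalIdeal R) : φ x = 0 := by
  rw [pi_eq_sum_univ' x, map_sum]
  refine Finset.sum_eq_zero fun j _ => ?_
  rw [map_smul, Algebra.smul_def, ResidueField.algebraMap_eq, (residue_eq_zero_iff _).2 (hx j),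
    zero_mul]

variable {m : ℕ} {f : Z →ₗ[R] (Fin m → R)} {g : (Fin m → R) →ₗ[R] N}
  (hf : Function.Injective f) (hfg : Function.Exact f g) (hg : Function.Surjective g)
  (hmin : ∀ z j, f z j ∈ maximalIdeal R)

include hmin in
theorem extMap_zero_eq_zero_of_minimal : extMap f (ResidueField R) 0 = 0 := by
  ext x
  obtain ⟨φ, rfl⟩ := (Abelian.Ext.mk₀_bijective _ _).2 x
  have : ModuleCat.ofHom f ≫ φ = 0 := by
    ext z
    exact linearMap_residueField_apply_eq_zero φ.hom (hmin z)
  simp [this]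

-- Every map from the free module to the residue field kills 𝔪F, hence the kernel of `g`, and so
-- factors through N.
include hfg hg hmin in
theorem extLen_zero_of_minimal : extLen R N (ResidueField R) 0 = m := by
  rw [← extLen_free_zero (R := R) m, extLen_zero, extLen_zero]
  refine (LinearEquiv.ofBijective (LinearMap.lcomp R (ResidueField R) g) ⟨?_, ?_⟩).length_eq
  · intro a b hab
    ext x
    obtain ⟨y, rfl⟩ := hg x
    exact LinearMap.congr_fun hab y
  · intro φ
    refine (LinearMap.exact_lcomp_of_exact_of_surjective _ hfg hg φ).1 ?_
    ext z
    exact linearMap_residueField_apply_eq_zero φ (hmin z)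

-- Minimality matters only for i = 0: there Hom(F, k) → Hom(Z, k) is zero, which makes the
-- connecting map injective; it is onto because Ext^1(F, k) = 0.
include hf hfg hg hmin in
theorem extLen_succ_of_minimal (i : ℕ) :
    extLen R N (ResidueField R) (i + 1) = extLen R Z (ResidueField R) i := by
  cases i with
  | succ i =>
    exact extLen_dimension_shift hf hfg hg (i + 1) (extLen_eq_zero_of_projective i)
      (extLen_eq_zero_of_projective (i + 1))
  | zero =>
    obtain ⟨δ, h1, h2, h3⟩ := ext_long_exact hf hfg hg (ResidueField R) 0
    have := (extLen_eq_zero_iff (R := R) (N := Fin m → R) (X := ResidueField R) 1).1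
      (extLen_eq_zero_of_projective 0)
    refine ((LinearEquiv.ofBijective δ ⟨?_, ?_⟩).length_eq).symm
    · rw [injective_iff_map_eq_zero]
      intro x hx
      obtain ⟨y, rfl⟩ := (h2 x).1 hx
      rw [extMap_zero_eq_zero_of_minimal hmin]
      rfl
    · intro y
      exact (h3 y).1 (Subsingleton.elim _ _)

end LocalRing

/-! ### Duality and permanence of total reflexivity -/

section Dual

variable {R : Type u} [CommRing R]
variable {A B C N N' : Type u} [AddCommGroup A] [Module R A] [AddCommGroup B] [Module R B]
  [AddCommGroup C] [Module R C] [AddCommGroup N] [Module R N] [AddCommGroup N'] [Module R N']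

theorem IsTotallyReflexive.of_extLen [Module.Finite R N] [Module.IsReflexive R N]
    (h : ∀ i, extLen R N R (i + 1) = 0) (h' : ∀ i, extLen R (Module.Dual R N) R (i + 1) = 0) :
    IsTotallyReflexive R N where
  finite := inferInstance
  reflexive := inferInstance
  ext_eq_zero
    | i + 1, _ => (extLen_eq_zero_iff _).1 (h i)
  ext_dual_eq_zero
    | i + 1, _ => (extLen_eq_zero_iff _).1 (h' i)

theorem IsTotallyReflexive.extLen_eq_zero (h : IsTotallyReflexive R N) (i : ℕ) :
    extLen R N R (i + 1) = 0 :=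
  (extLen_eq_zero_iff _).2 (h.ext_eq_zero (i + 1) i.succ_pos)

theorem IsTotallyReflexive.extLen_dual_eq_zero (h : IsTotallyReflexive R N) (i : ℕ) :
    extLen R (Module.Dual R N) R (i + 1) = 0 :=
  (extLen_eq_zero_iff _).2 (h.ext_dual_eq_zero (i + 1) i.succ_pos)

/-- The dual of a finite direct sum. -/
noncomputable def dualPiEquiv (a : ℕ) (N : Type u) [AddCommGroup N] [Module R N] :
    (Fin a → Module.Dual R N) ≃ₗ[R] Module.Dual R (Fin a → N) :=
  LinearMap.lsum R (fun _ : Fin a => N) R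

theorem IsTotallyReflexive.congr (e : N ≃ₗ[R] N') (h : IsTotallyReflexive R N) :
    IsTotallyReflexive R N' := by
  have := h.finite
  have := h.reflexive
  have := Module.Finite.equiv e
  have := Module.equiv e
  refine .of_extLen (fun i => ?_) (fun i => ?_)
  · rw [← extLen_congr e, h.extLen_eq_zero]
  · rw [extLen_congr e.dualMap, h.extLen_dual_eq_zero]

theorem IsTotallyReflexive.dual [IsNoetherianRing R] (h : IsTotallyReflexive R N) :
    IsTotallyReflexive R (Module.Dual R N) := by
  have := h.finite
  have := h.reflexive
  refine .of_extLen h.extLen_dual_eq_zero (fun i => ?_)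
  rw [← extLen_congr (Module.evalEquiv R N), h.extLen_eq_zero]

section ShortExact

variable {f : A →ₗ[R] B} {g : B →ₗ[R] C} (hf : Function.Injective f)
    (hfg : Function.Exact f g) (hg : Function.Surjective g)

include hfg hg in
theorem exact_dualMap : Function.Exact g.dualMap f.dualMap :=
  LinearMap.exact_lcomp_of_exact_of_surjective R hfg hg

include hf hfg hg

theorem dualMap_surjective_of_extLen (h : extLen R C R 1 = 0) : Function.Surjective f.dualMap :=
  fun φ => exists_extension_of_extLen_eq_zero hf hfg hg h φ

/-- Five-lemma chase between the sequence and its double dual: Ext^1(C, R) = 0 makes the dual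
sequence short exact, so A** → B** is injective and the double dual is exact at B**. -/
theorem isReflexive_middle [Module.IsReflexive R A] [Module.IsReflexive R C]
    (hC : extLen R C R 1 = 0) (hA : extLen R (Module.Dual R A) R 1 = 0) :
    Module.IsReflexive R B := by
  have h1 := exact_dualMap hfg hg
  have h2 := dualMap_surjective_of_extLen hf hfg hg hC
  have h0 := LinearMap.dualMap_injective_of_surjective hg
  have k1 := exact_dualMap h1 h2
  have k2 := dualMap_surjective_of_extLen h0 h1 h2 hA
  have k0 := LinearMap.dualMap_injective_of_surjective h2
  have bA := Module.bijective_dual_eval R A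
  have bC := Module.bijective_dual_eval R C
  constructor
  constructor
  · rw [injective_iff_map_eq_zero]
    intro x hx
    have : Module.Dual.eval R C (g x) = 0 := by
      have h : Module.Dual.eval R C (g x) = g.dualMap.dualMap (Module.Dual.eval R B x) := rfl
      rw [h, hx, map_zero]
    obtain ⟨y, rfl⟩ := (hfg x).1 (bC.1 (this.trans (map_zero _).symm))
    have : f.dualMap.dualMap (Module.Dual.eval R A y) = 0 := hx
    have := bA.1 ((k0 (this.trans (map_zero _).symm)).trans (map_zero _).symm)
    rw [this, map_zero]
  · intro ξ
    obtain ⟨c, hc⟩ := bC.2 (g.dualMap.dualMap ξ)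
    obtain ⟨x, rfl⟩ := hg c
    have : g.dualMap.dualMap (ξ - Module.Dual.eval R B x) = 0 := by
      rw [map_sub, ← hc, sub_eq_zero]; rfl
    obtain ⟨α, hα⟩ := (k1 _).1 this
    obtain ⟨y, rfl⟩ := bA.2 α
    refine ⟨f y + x, ?_⟩
    rw [map_add, ← eq_sub_iff_add_eq, ← hα]
    rfl

theorem isReflexive_left [Module.IsReflexive R B] [Module.IsReflexive R C]
    (hC : extLen R C R 1 = 0) : Module.IsReflexive R A := by
  have h1 := exact_dualMap hfg hg
  have h2 := dualMap_surjective_of_extLen hf hfg hg hC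
  have k1 := exact_dualMap h1 h2
  have k0 := LinearMap.dualMap_injective_of_surjective h2
  have bB := Module.bijective_dual_eval R B
  have bC := Module.bijective_dual_eval R C
  constructor
  constructor
  · intro x y hxy
    apply hf
    apply bB.1
    exact congrArg f.dualMap.dualMap hxy
  · intro ξ
    obtain ⟨b, hb⟩ := bB.2 (f.dualMap.dualMap ξ)
    have : Module.Dual.eval R C (g b) = 0 := by
      have h : Module.Dual.eval R C (g b) = g.dualMap.dualMap (Module.Dual.eval R B b) := rfl
      rw [h, hb]
      exact k1.apply_apply_eq_zero ξ
    obtain ⟨y, rfl⟩ := (hfg b).1 (bC.1 (this.trans (map_zero _).symm))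
    exact ⟨y, k0 hb⟩

theorem IsTotallyReflexive.middle [Module.Finite R B] (hA : IsTotallyReflexive R A)
    (hC : IsTotallyReflexive R C) : IsTotallyReflexive R B := by
  have := hA.reflexive
  have := hC.reflexive
  have := isReflexive_middle hf hfg hg (hC.extLen_eq_zero 0) (hA.extLen_dual_eq_zero 0)
  refine .of_extLen (fun i => ?_) (fun i => ?_)
  · simpa [hA.extLen_eq_zero i, hC.extLen_eq_zero i] using
      extLen_middle_le (X := R) hf hfg hg (i + 1)
  · simpa [hA.extLen_dual_eq_zero i, hC.extLen_dual_eq_zero i] using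
      extLen_middle_le (X := R) (LinearMap.dualMap_injective_of_surjective hg)
        (exact_dualMap hfg hg) (dualMap_surjective_of_extLen hf hfg hg (hC.extLen_eq_zero 0))
        (i + 1)

/-- A syzygy of a totally reflexive module is totally reflexive. -/
theorem IsTotallyReflexive.left [Module.Finite R A] [Module.Finite R B] [Module.Free R B]
    (hC : IsTotallyReflexive R C) : IsTotallyReflexive R A := by
  have := hC.reflexive
  have := isReflexive_left hf hfg hg (hC.extLen_eq_zero 0)
  have h0 := LinearMap.dualMap_injective_of_surjective hg
  have h1 := exact_dualMap hfg hg
  have h2 := dualMap_surjective_of_extLen hf hfg hg (hC.extLen_eq_zero 0)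
  refine .of_extLen (fun i => ?_) (fun i => ?_)
  · have := extLen_left_le (X := R) hf hfg hg (i + 1)
    rwa [extLen_eq_zero_of_projective (N := B), hC.extLen_eq_zero, add_zero, nonpos_iff_eq_zero] at this
  · cases i with
    | succ i =>
      have := extLen_right_le (X := R) h0 h1 h2 (i + 1)
      rwa [extLen_eq_zero_of_projective (N := Module.Dual R B), hC.extLen_dual_eq_zero, add_zero,
        nonpos_iff_eq_zero] at this
    | zero =>
      -- Ext^1(A*, R) is out of reach of dimension shifting. A functional on C* is evaluation at
      -- some c; lifting c to b, evaluation at b extends it to B*. So δ = 0, while δ is onto since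
      -- B* is projective.
      obtain ⟨δ, k1, k2, k3⟩ := ext_long_exact h0 h1 h2 R 0
      have := (extLen_eq_zero_iff 1).1
        (extLen_eq_zero_of_projective (R := R) (N := Module.Dual R B) (X := R) 0)
      rw [zero_add, extLen_eq_zero_iff]
      refine subsingleton_of_forall_eq 0 fun y => ?_
      obtain ⟨x, rfl⟩ := (k3 y).1 (Subsingleton.elim _ _)
      refine (k2 x).2 ?_
      obtain ⟨φ, rfl⟩ := (Abelian.Ext.mk₀_bijective _ _).2 x
      obtain ⟨c, hc⟩ := (Module.bijective_dual_eval R C).2 φ.hom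
      obtain ⟨b, rfl⟩ := hg c
      refine ⟨Abelian.Ext.mk₀ (ModuleCat.ofHom (Module.Dual.eval R B b)), ?_⟩
      simp only [Abelian.Ext.bilinearCompOfLinear_apply_apply, Abelian.Ext.mk₀_comp_mk₀]
      congr 1
      ext x
      exact LinearMap.congr_fun hc x

end ShortExact

theorem isReflexive_pi [Module.IsReflexive R N] (a : ℕ) : Module.IsReflexive R (Fin a → N) := by
  induction a with
  | zero => infer_instance
  | succ a ih => exact Module.equiv (Fin.consLinearEquiv R fun _ : Fin (a + 1) => N)

theorem IsTotallyReflexive.pi (h : IsTotallyReflexive R N) (a : ℕ) :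
    IsTotallyReflexive R (Fin a → N) := by
  have := h.finite
  have := h.reflexive
  have := isReflexive_pi (R := R) (N := N) a
  refine .of_extLen (fun i => ?_) (fun i => ?_)
  · rw [extLen_pi, h.extLen_eq_zero, mul_zero]
  · rw [← extLen_congr (dualPiEquiv a N), extLen_pi, h.extLen_dual_eq_zero, mul_zero]

end Dual

/-! ### Syzygies, their duals, and Betti numbers as Ext lengths -/

section Syzygy

open IsLocalRing

variable {R : Type u} [CommRing R] [IsNoetherianRing R] [IsLocalRing R]
variable (N : Type u) [AddCommGroup N] [Module R N] [Module.Finite R N]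

/-- The inclusion of a syzygy into a free module. -/
noncomputable def syzygyInclusion (n : ℕ) :
    Syzygy R N (n + 1) →ₗ[R] (Fin ((minimalFreeResolution R N).rank n) → R) :=
  Submodule.liftQ _ ((minimalFreeResolution R N).d n)
    (LinearMap.exact_iff.mp ((minimalFreeResolution R N).exact_succ n)).ge

theorem syzygyInclusion_injective (n : ℕ) : Function.Injective (syzygyInclusion (R := R) N n) := by
  rw [← LinearMap.ker_eq_bot, syzygyInclusion]
  exact Submodule.ker_liftQ_eq_bot _ _ _
    (LinearMap.exact_iff.mp ((minimalFreeResolution R N).exact_succ n)).le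

theorem syzygyInclusion_exact (n : ℕ) : Function.Exact (syzygyInclusion (R := R) N n)
    (Submodule.mkQ (LinearMap.range ((minimalFreeResolution R N).d n))) := by
  rw [LinearMap.exact_iff, Submodule.ker_mkQ, syzygyInclusion, Submodule.range_liftQ]

theorem syzygyInclusion_mem (n : ℕ) (z : Syzygy R N (n + 1))
    (j : Fin ((minimalFreeResolution R N).rank n)) :
    syzygyInclusion (R := R) N n z j ∈ maximalIdeal R := by
  obtain ⟨x, rfl⟩ := Submodule.mkQ_surjective _ z
  exact (minimalFreeResolution R N).minimal n x j

theorem IsTotallyReflexive.syzygy (h : IsTotallyReflexive R N) (n : ℕ) :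
    IsTotallyReflexive R (Syzygy R N n) := by
  induction n with
  | zero => exact h.congr (syzygyZeroEquiv R N).symm
  | succ n ih =>
    exact ih.left (syzygyInclusion_injective N n) (syzygyInclusion_exact N n)
      (Submodule.mkQ_surjective _)

theorem extLen_syzygy (n i : ℕ) : extLen R (Syzygy R N n) (ResidueField R) i =
    extLen R N (ResidueField R) (i + n) := by
  induction n generalizing i with
  | zero => exact extLen_congr (syzygyZeroEquiv R N) i
  | succ n ih =>
    rw [show i + (n + 1) = i + 1 + n by omega, ← ih, extLen_succ_of_minimal (syzygyInclusion_injective N n)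
      (syzygyInclusion_exact N n) (Submodule.mkQ_surjective _) (syzygyInclusion_mem N n)]

/-- This frees the Betti numbers from the chosen resolution and opens them to long exact sequences.
-/
theorem extLen_residueField (n : ℕ) : extLen R N (ResidueField R) n = betti R N n := by
  have h := extLen_syzygy (R := R) N n 0
  rw [zero_add] at h
  rw [← h, extLen_zero_of_minimal (syzygyInclusion_exact N n)
    (Submodule.mkQ_surjective _) (syzygyInclusion_mem N n)]
  rfl

/-- Dualizing 0 → Ω^{n+1}N → F → Ω^n N → 0 exhibits (Ω^n N)* as a first syzygy of (Ω^{n+1}N)*, so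
the shift is opposite to that of `extLen_syzygy`. The cover by F* need not be minimal, hence the
restriction to positive degrees. -/
theorem extLen_dual_syzygy (h : IsTotallyReflexive R N) (n i : ℕ) :
    extLen R (Module.Dual R (Syzygy R N n)) (ResidueField R) (i + 1 + n) =
      extLen R (Module.Dual R N) (ResidueField R) (i + 1) := by
  induction n with
  | zero => exact extLen_congr (syzygyZeroEquiv R N).dualMap.symm (i + 1)
  | succ n ih =>
    have hf := syzygyInclusion_injective (R := R) N n
    have hfg := syzygyInclusion_exact (R := R) N n
    have hg := Submodule.mkQ_surjective (LinearMap.range ((minimalFreeResolution R N).d n))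
    rw [← ih, ← add_assoc]
    have h0 : ∀ j, extLen R (Module.Dual R (Fin ((minimalFreeResolution R N).rank n) → R))
        (ResidueField R) (j + 1) = 0 := extLen_eq_zero_of_projective
    refine extLen_dimension_shift (LinearMap.dualMap_injective_of_surjective hg)
      (exact_dualMap hfg hg) (dualMap_surjective_of_extLen hf hfg hg
        ((h.syzygy N n).extLen_eq_zero 0)) _ ?_ (h0 _)
    rw [add_right_comm]
    exact h0 _

theorem subsingleton_syzygy_of_betti_eq_zero (n : ℕ) (h : betti R N n = 0) :
    Subsingleton (Syzygy R N n) := by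
  have : IsEmpty (Fin ((minimalFreeResolution R N).rank n)) := by
    have h : (minimalFreeResolution R N).rank n = 0 := h
    rw [h]
    infer_instance
  exact (Submodule.mkQ_surjective (LinearMap.range ((minimalFreeResolution R N).d n))).subsingleton

end Syzygy

/-! ### Growth of integer sequences under a shifted recursion -/

section Numerical

variable {u : ℕ → ℕ} {a b s c : ℕ}

theorem le_of_shift_le (hs : 1 ≤ s) {i₀ m : ℕ} (h : ∀ i ≥ i₀, u (i + s) ≤ u i + c)
    (h0 : ∀ i < i₀ + s, u i ≤ m) (i : ℕ) : u i ≤ m + c * i := by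
  induction i using Nat.strong_induction_on with
  | _ i ih =>
    by_cases hi : i < i₀ + s
    · exact (h0 i hi).trans (Nat.le_add_right _ _)
    · have h1 := ih (i - s) (by omega)
      have h2 := h (i - s) (by omega)
      rw [Nat.sub_add_cancel (by omega)] at h2
      -- Since s ≥ 1, moving by s raises the linear bound by at least c.
      have h3 : c * (i - s) + c ≤ c * i := by
        rw [← Nat.mul_succ]
        exact Nat.mul_le_mul_left _ (by omega)
      omega

theorem exists_initial_bound (u : ℕ → ℕ) (k : ℕ) : ∃ m, ∀ i < k, u i ≤ m :=
  ⟨(Finset.range k).sup u, fun _ hi => Finset.le_sup (Finset.mem_range.2 hi)⟩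

theorem exists_linear_bound (hs : 1 ≤ s) (hb : 1 ≤ b) (hab : a ≤ b) {i₀ : ℕ}
    (h : ∀ i ≥ i₀, b * u (i + s) ≤ a * u i + c) : ∃ m, ∀ i, u i ≤ m + c * i := by
  obtain ⟨m, hm⟩ := exists_initial_bound u (i₀ + s)
  refine ⟨m, le_of_shift_le hs (fun i hi => ?_) hm⟩
  refine Nat.le_of_mul_le_mul_left ?_ hb
  calc b * u (i + s) ≤ a * u i + c := h i hi
    _ ≤ b * u i + b * c := add_le_add (Nat.mul_le_mul_right _ hab) (Nat.le_mul_of_pos_left _ hb)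
    _ = b * (u i + c) := (mul_add _ _ _).symm

theorem exists_bound_of_shift (hs : 1 ≤ s) (hb : 1 ≤ b) (hab : a ≤ b) {i₀ : ℕ}
    (h : ∀ i ≥ i₀, b * u (i + s) ≤ a * u i) : ∃ m, ∀ i, u i ≤ m := by
  simpa using exists_linear_bound (c := 0) hs hb hab h

/-- A positive value at i + s must be strictly below the value at i. Starting from a bound m, after
m shifts nothing positive is left. -/
theorem eventually_zero_of_shift (hs : 1 ≤ s) (hab : a < b) {i₀ : ℕ}
    (h : ∀ i ≥ i₀, b * u (i + s) ≤ a * u i) : ∃ k, ∀ i ≥ k, u i = 0 := by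
  obtain ⟨m, hm⟩ := exists_bound_of_shift hs (by omega) hab.le h
  suffices H : ∀ t, ∀ i ≥ i₀ + s * t, u i ≤ m - t by
    exact ⟨i₀ + s * m, fun i hi => by have := H m i hi; omega⟩
  intro t
  induction t with
  | zero => exact fun i _ => hm i
  | succ t ih =>
    intro i hi
    rw [Nat.mul_succ] at hi
    have h1 := ih (i - s) (by omega)
    have h2 := h (i - s) (by have := Nat.zero_le (s * t); omega)
    rw [Nat.sub_add_cancel (by omega)] at h2
    by_contra hcon
    have h3 : u (i - s) ≤ u i := by omega
    have h4 : b * u i ≤ a * u i := h2.trans (Nat.mul_le_mul_left _ h3)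
    have h5 : 0 < u i := by omega
    exact absurd (Nat.le_of_mul_le_mul_right h4 h5) (by omega)

end Numerical

/-! ### Betti numbers along a reducing sequence -/

section Betti

open IsLocalRing

variable {R : Type u} [CommRing R] [IsNoetherianRing R] [IsLocalRing R]
variable {A B C N N' : Type u} [AddCommGroup A] [Module R A] [AddCommGroup B] [Module R B]
  [AddCommGroup C] [Module R C] [AddCommGroup N] [Module R N] [AddCommGroup N'] [Module R N']
  [Module.Finite R A] [Module.Finite R B] [Module.Finite R C] [Module.Finite R N]
  [Module.Finite R N']

theorem betti_congr (e : N ≃ₗ[R] N') : betti R N = betti R N' := by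
  ext i
  exact_mod_cast (extLen_residueField (R := R) N i).symm.trans
    ((extLen_congr e i).trans (extLen_residueField N' i))

theorem betti_pi (a i : ℕ) : betti R (Fin a → N) i = a * betti R N i := by
  have := extLen_pi (R := R) (N := N) (X := ResidueField R) a i
  rw [extLen_residueField, extLen_residueField] at this
  exact_mod_cast this

theorem betti_dual_pi (a i : ℕ) :
    betti R (Module.Dual R (Fin a → N)) i = a * betti R (Module.Dual R N) i := by
  rw [← betti_congr (dualPiEquiv a N), betti_pi]

theorem betti_syzygy (n i : ℕ) : betti R (Syzygy R N n) i = betti R N (i + n) := by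
  have := extLen_syzygy (R := R) N n i
  rw [extLen_residueField, extLen_residueField] at this
  exact_mod_cast this

theorem betti_dual_syzygy (h : IsTotallyReflexive R N) (n i : ℕ) :
    betti R (Module.Dual R (Syzygy R N n)) (i + 1 + n) = betti R (Module.Dual R N) (i + 1) := by
  have := extLen_dual_syzygy (R := R) N h n i
  rw [extLen_residueField, extLen_residueField] at this
  exact_mod_cast this

theorem betti_dual_dual (h : IsTotallyReflexive R N) :
    betti R (Module.Dual R (Module.Dual R N)) = betti R N :=
  have := h.reflexive
  (betti_congr (Module.evalEquiv R N)).symm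

theorem betti_right_le {f : A →ₗ[R] B} {g : B →ₗ[R] C} (hf : Function.Injective f)
    (hfg : Function.Exact f g) (hg : Function.Surjective g) (i : ℕ) :
    betti R C (i + 1) ≤ betti R A i + betti R B (i + 1) := by
  have := extLen_right_le (X := ResidueField R) hf hfg hg i
  simp only [extLen_residueField] at this
  exact_mod_cast this

theorem betti_eventually_zero_of_projectiveDimension_lt_top
    (h : projectiveDimension (ModuleCat.of R N) < ⊤) : ∃ k, ∀ i ≥ k, betti R N i = 0 := by
  obtain ⟨n, hn⟩ := (projectiveDimension_ne_top_iff _).1 h.ne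
  refine ⟨n + 1, fun i hi => ?_⟩
  have : extLen R N (ResidueField R) i = 0 := by
    rw [extLen_eq_zero_iff]
    exact HasProjectiveDimensionLT.subsingleton _ (n + 1) i hi _
  rw [extLen_residueField] at this
  exact_mod_cast this

/-- The Betti numbers of the dual of a totally reflexive module vanish in positive degrees as soon
as one Betti number of the module vanishes. -/
theorem betti_dual_eq_zero (h : IsTotallyReflexive R N) {k : ℕ} (hk : betti R N k = 0) (i : ℕ) :
    betti R (Module.Dual R N) (i + 1) = 0 := by
  -- Ω^k N = 0, so its dual has no Ext; the dual shift carries this back to N*.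
  have := subsingleton_syzygy_of_betti_eq_zero N k hk
  rw [← betti_dual_syzygy h k]
  have := extLen_eq_zero_of_subsingleton (R := R) (N := Module.Dual R (Syzygy R N k))
    (X := ResidueField R) (i + 1 + k)
  rw [extLen_residueField] at this
  exact_mod_cast this

theorem complexity_le_two {m c : ℕ} (h : ∀ i, betti R N i ≤ m + c * i) : complexity R N ≤ 2 := by
  -- For r = 2 the exponent is 1, and m + c n ≤ (m + c) n once n ≥ 1.
  refine iInf₂_le 2 ⟨m + c, ?_⟩
  filter_upwards [Filter.eventually_ge_atTop 1] with n hn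
  have h1 : (betti R N n : ℝ) ≤ m + c * n := by exact_mod_cast h n
  have h2 : (1 : ℝ) ≤ n := by exact_mod_cast hn
  have h3 : (m : ℝ) ≤ m * n := le_mul_of_one_le_right (Nat.cast_nonneg m) h2
  norm_num
  linarith

/-- A module and its dual both have bounded Betti numbers. -/
def HasBoundedBetti (R : Type u) [CommRing R] [IsNoetherianRing R] [IsLocalRing R]
    (N : Type u) [AddCommGroup N] [Module R N] [Module.Finite R N] : Prop :=
  ∃ c, ∀ i, betti R N i ≤ c ∧ betti R (Module.Dual R N) i ≤ c

theorem exists_bound_of_eventually_zero {u : ℕ → ℕ} (h : ∃ k, ∀ i ≥ k, u i = 0) :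
    ∃ m, ∀ i, u i ≤ m := by
  obtain ⟨k, hk⟩ := h
  obtain ⟨m, hm⟩ := exists_initial_bound u k
  refine ⟨m, fun i => ?_⟩
  by_cases hi : i < k
  · exact hm i hi
  · simp [hk i (not_lt.1 hi)]

theorem HasBoundedBetti.of_bounds (h : ∃ m, ∀ i, betti R N i ≤ m)
    (h' : ∃ m, ∀ i, betti R (Module.Dual R N) i ≤ m) : HasBoundedBetti R N := by
  obtain ⟨m, hm⟩ := h
  obtain ⟨m', hm'⟩ := h'
  exact ⟨max m m', fun i => ⟨(hm i).trans (le_max_left _ _), (hm' i).trans (le_max_right _ _)⟩⟩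

theorem HasBoundedBetti.of_eventually_zero (h : IsTotallyReflexive R N)
    (hN : ∃ k, ∀ i ≥ k, betti R N i = 0) : HasBoundedBetti R N := by
  -- The threshold is 1 because β_0(N*) may be nonzero.
  refine .of_bounds (exists_bound_of_eventually_zero hN) (exists_bound_of_eventually_zero ⟨1, ?_⟩)
  obtain ⟨k, hk⟩ := hN
  intro i hi
  obtain ⟨i, rfl⟩ := Nat.exists_eq_add_of_le' hi
  exact betti_dual_eq_zero h (hk k le_rfl) i

theorem HasBoundedBetti.of_dual_eventually_zero (h : IsTotallyReflexive R N)
    (hN : ∃ k, ∀ i ≥ k, betti R (Module.Dual R N) i = 0) : HasBoundedBetti R N := by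
  obtain ⟨c, hc⟩ := HasBoundedBetti.of_eventually_zero h.dual hN
  exact ⟨c, fun i => ⟨by simpa [betti_dual_dual h] using (hc i).2, (hc i).1⟩⟩

section ReducingStep

variable {K L : Type u} [AddCommGroup K] [Module R K] [AddCommGroup L] [Module R L]
  [Module.Finite R K] [Module.Finite R L] {a b n : ℕ}
  {f : (Fin a → K) →ₗ[R] L} {g : L →ₗ[R] (Fin b → Syzygy R K n)}
  (hf : Function.Injective f) (hfg : Function.Exact f g) (hg : Function.Surjective g)
include hf hfg hg

theorem betti_reducing_le (i : ℕ) :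
    b * betti R K (i + (n + 1)) ≤ a * betti R K i + betti R L (i + 1) := by
  have := betti_right_le hf hfg hg i
  rwa [betti_pi, betti_pi, betti_syzygy, add_assoc, add_comm 1 n] at this

/-- The dual sequence has (K*)^a as its quotient and the dual of (Ω^n K)^b as its submodule, which
is why a and b trade places. The bound i ≥ 1 comes from the shift for dual syzygies. -/
theorem betti_dual_reducing_le (hK : IsTotallyReflexive R K) (i : ℕ) (hi : 1 ≤ i) :
    a * betti R (Module.Dual R K) (i + (n + 1)) ≤
      b * betti R (Module.Dual R K) i + betti R (Module.Dual R L) (i + n + 1) := by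
  have hS := (hK.syzygy K n).pi b
  have := betti_right_le (LinearMap.dualMap_injective_of_surjective hg) (exact_dualMap hfg hg)
    (dualMap_surjective_of_extLen hf hfg hg (hS.extLen_eq_zero 0)) (i + n)
  obtain ⟨i, rfl⟩ := Nat.exists_eq_add_of_le' hi
  rwa [betti_dual_pi, betti_dual_pi, betti_dual_syzygy hK, add_assoc (i + 1) n 1] at this

theorem isTotallyReflexive_reducing (hK : IsTotallyReflexive R K) : IsTotallyReflexive R L :=
  (hK.pi a).middle hf hfg hg ((hK.syzygy K n).pi b)

/-- If a ≤ b the recursion for K has bounded increments; if b ≤ a the one for K* does. -/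
theorem complexity_le_two_of_reducing (ha : 1 ≤ a) (hb : 1 ≤ b) (hK : IsTotallyReflexive R K)
    (hL : HasBoundedBetti R L) : complexity R K ≤ 2 ∨ complexity R (Module.Dual R K) ≤ 2 := by
  obtain ⟨c, hc⟩ := hL
  rcases le_total a b with hab | hab
  · obtain ⟨m, hm⟩ := exists_linear_bound (u := betti R K) (c := c) (i₀ := 0) (s := n + 1)
      (by omega) hb hab fun i _ => (betti_reducing_le hf hfg hg i).trans
        (Nat.add_le_add_left (hc _).1 _)
    exact .inl (complexity_le_two hm)
  · obtain ⟨m, hm⟩ := exists_linear_bound (u := betti R (Module.Dual R K)) (c := c) (i₀ := 1)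
      (s := n + 1) (by omega) ha hab fun i hi =>
        (betti_dual_reducing_le hf hfg hg hK i hi).trans (Nat.add_le_add_left (hc _).2 _)
    exact .inr (complexity_le_two hm)

/-- Both K and K* must be controlled, since the preceding step may need either. A strict inequality
between a and b forces eventual vanishing on one side, which total reflexivity transfers; equality
bounds both sides directly. -/
theorem hasBoundedBetti_of_reducing (ha : 1 ≤ a) (hb : 1 ≤ b) (hK : IsTotallyReflexive R K)
    (hL : ∃ k, ∀ i ≥ k, betti R L i = 0) : HasBoundedBetti R K := by
  obtain ⟨k, hk⟩ := hL
  have hL := isTotallyReflexive_reducing hf hfg hg hK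
  have h1 : ∀ i ≥ k, b * betti R K (i + (n + 1)) ≤ a * betti R K i := fun i hi => by
    simpa [hk (i + 1) (by omega)] using betti_reducing_le hf hfg hg i
  have h2 : ∀ i ≥ 1, a * betti R (Module.Dual R K) (i + (n + 1)) ≤
      b * betti R (Module.Dual R K) i := fun i hi => by
    simpa [betti_dual_eq_zero hL (hk k le_rfl) (i + n)] using
      betti_dual_reducing_le hf hfg hg hK i hi
  rcases lt_trichotomy a b with hab | hab | hab
  · exact .of_eventually_zero hK (eventually_zero_of_shift (by omega) hab h1)
  · exact .of_bounds (exists_bound_of_shift (by omega) hb hab.le h1)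
      (exists_bound_of_shift (by omega) ha hab.ge h2)
  · exact .of_dual_eventually_zero hK (eventually_zero_of_shift (by omega) hab h2)

end ReducingStep

theorem HasBoundedBetti.complexity_le_two (h : HasBoundedBetti R N) : complexity R N ≤ 2 := by
  obtain ⟨c, hc⟩ := h
  exact _root_.complexity_le_two (m := c) (c := 0) fun i => by simpa using (hc i).1

theorem complexity_congr (e : N ≃ₗ[R] N') : complexity R N = complexity R N' := by
  simp only [complexity, betti_congr e]

theorem complexity_or_dual_le_congr (e : N ≃ₗ[R] N') {c : ℕ∞}
    (h : complexity R N ≤ c ∨ complexity R (Module.Dual R N) ≤ c) :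
    complexity R N' ≤ c ∨ complexity R (Module.Dual R N') ≤ c := by
  rwa [← complexity_congr e, complexity_congr e.dualMap]

theorem ReducingPdSequence.complexity_le_two {r : ℕ} (S : ReducingPdSequence R N r)
    (hN : IsTotallyReflexive R N) (hr : r ≤ 2) :
    complexity R N ≤ 2 ∨ complexity R (Module.Dual R N) ≤ 2 := by
  have := S.finite
  have hT : ∀ i, IsTotallyReflexive R (S.K i) := by
    intro i
    induction i using Fin.induction with
    | zero => exact hN.congr S.iso.symm
    | succ i ih =>
      exact isTotallyReflexive_reducing (S.f_injective i) (S.exact i) (S.g_surjective i) ih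
  refine complexity_or_dual_le_congr S.iso ?_
  have hlast : ∃ k, ∀ i ≥ k, betti R (S.K (Fin.last r)) i = 0 :=
    betti_eventually_zero_of_projectiveDimension_lt_top S.pd_last_lt_top
  interval_cases r
  · exact .inl (HasBoundedBetti.of_eventually_zero (hT 0) hlast).complexity_le_two
  · exact .inl (hasBoundedBetti_of_reducing (S.f_injective 0) (S.exact 0) (S.g_surjective 0)
      (S.one_le_a 0) (S.one_le_b 0) (hT 0) hlast).complexity_le_two
  · exact complexity_le_two_of_reducing (S.f_injective 0) (S.exact 0) (S.g_surjective 0)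
      (S.one_le_a 0) (S.one_le_b 0) (hT 0) (hasBoundedBetti_of_reducing (S.f_injective 1)
      (S.exact 1) (S.g_surjective 1) (S.one_le_a 1) (S.one_le_b 1) (hT 1) hlast)

end Betti

theorem proposition4p8 (R : Type u) [CommRing R] [IsNoetherianRing R] [IsLocalRing R]
    (M : Type u) [AddCommGroup M] [Module R M] [Module.Finite R M]
    (hM : IsTotallyReflexive R M) (hrpd : reducingPd R M ≤ 2) :
    complexity R M ≤ 2 ∨ complexity R (Module.Dual R M) ≤ 2 := by
  -- A strict bound on the infimum yields an actual sequence, of length r < 3.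
  have h : reducingPd R M < 3 := hrpd.trans_lt (by norm_num)
  simp only [reducingPd, iInf_lt_iff] at h
  obtain ⟨r, ⟨S⟩, hr⟩ := h
  have hr : r < 3 := by exact_mod_cast hr
  exact S.complexity_le_two hM (by omega)
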